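/- Let $p$ be a prime and let $\nu$ be a positive integer. Let $A$ be a finite abelian group (written additively) with $p\nmid |A|$ and let $P$ be a finite abelian $p$-group. For a finite abelian group $G$, an abelian code in the group algebra $\mathbb{F}_{p^{2\nu}}[G]$ is an ideal $C$ of $\mathbb{F}_{p^{2\nu}}[G]$. Its Hermitian dual is $C^{\perp_{\rm H}}=\{v\in\mathbb{F}_{p^{2\nu}}[G] \mid \langle c,v\rangle_{\rm H}=0 \text{ for all } c\in C\}$, where $\langle u,v\rangle_{\rm H}=\sum_{g\in G}u_g v_g^{p^\nu}$ for $u=\sum_{g\in G}u_gY^g$ and $v=\sum_{g\in G}v_gY^g$, and $C$ is Hermitian complementary dual if $C\cap C^{\perp_{\rm H}}=\{0\}$. For $a\in A$, let $S_{p^{2\nu}}(a)=\{p^{2\nu i}\cdot a \mid i=0,1,2,\dots\}$ be the $p^{2\nu}$-cyclotomic class of $A$ containing $a$. This class is of type ${\rm I'}$ if $S_{p^{2\nu}}(a)=S_{p^{2\nu}}(-p^\nu\cdot a)$, and of type ${\rm II'}$ otherwise. Let $r_{\rm I'}$ be the number of $p^{2\nu}$-cyclotomic classes of $A$ of type ${\rm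 I'}$, and let $r_{\rm II'}$ be the number of unordered pairs $\{S_{p^{2\nu}}(a),S_{p^{2\nu}}(-p^\nu\cdot a)\}$ with $a\in A$ and $S_{p^{2\nu}}(a)$ of type ${\rm II'}$. Then the number of Hermitian complementary dual abelian codes in $\mathbb{F}_{p^{2\nu}}[A\times P]$ is \[2^{r_{\rm I'}+r_{\rm II'}}.\] In particular, this number does not depend on $P$: it is the same for every finite abelian $p$-group $P$. -/

import Mathlib

namespace HermitianLCD

section Codes

variable {F G : Type*} [Field F] [AddCommGroup G] [Fintype G]

/-- The Hermitian inner product `∑ g, u_g * v_g ^ (p ^ ν)` on the group algebra `F[G]`, where `F`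
is a field with `p ^ (2 * ν)` elements and `G` is a finite abelian group written additively. -/
def hermitianInner (p ν : ℕ) (u v : AddMonoidAlgebra F G) : F :=
  ∑ g : G, u.coeff g * v.coeff g ^ (p ^ ν)

/-- The Hermitian dual of an abelian code, that is, of an ideal `C` of the group algebra. -/
def hermitianDual (p ν : ℕ) (C : Ideal (AddMonoidAlgebra F G)) : Set (AddMonoidAlgebra F G) :=
  {v | ∀ c ∈ C, hermitianInner p ν c v = 0}

/-- An abelian code is Hermitian complementary dual if it meets its Hermitian dual only in `0`. -/
def IsHermitianComplementaryDual (p ν : ℕ) (C : Ideal (AddMonoidAlgebra F G)) : Prop :=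
  (C : Set (AddMonoidAlgebra F G)) ∩ hermitianDual p ν C = {0}

/-- The number of Hermitian complementary dual abelian codes in `F[G]`. -/
noncomputable def numHermitianComplementaryDual (p ν : ℕ) (F G : Type*) [Field F]
    [AddCommGroup G] [Fintype G] : ℕ :=
  {C : Ideal (AddMonoidAlgebra F G) | IsHermitianComplementaryDual p ν C}.ncard

end Codes

section CyclotomicClasses

variable {A : Type*} [AddCommGroup A]

/-- The `q`-cyclotomic class `{q ^ i • a | i = 0, 1, 2, …}` of `A` containing `a`. -/
def cyclotomicClass (q : ℕ) (a : A) : Set A :=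
  {b | ∃ i : ℕ, b = q ^ i • a}

/-- The class of `a` is of type I′ if it equals the class of `-p ^ ν • a`. -/
def IsTypeI' (p ν : ℕ) (a : A) : Prop :=
  cyclotomicClass (p ^ (2 * ν)) a = cyclotomicClass (p ^ (2 * ν)) (-(p ^ ν • a))

/-- The class of `a` is of type II′ if it differs from the class of `-p ^ ν • a`. -/
def IsTypeII' (p ν : ℕ) (a : A) : Prop :=
  cyclotomicClass (p ^ (2 * ν)) a ≠ cyclotomicClass (p ^ (2 * ν)) (-(p ^ ν • a))

/-- The number of `p ^ (2 * ν)`-cyclotomic classes of `A` of type I′. -/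
noncomputable def rI' (p ν : ℕ) (A : Type*) [AddCommGroup A] : ℕ :=
  {S : Set A | ∃ a : A, IsTypeI' p ν a ∧ S = cyclotomicClass (p ^ (2 * ν)) a}.ncard

/-- The number of unordered pairs of `p ^ (2 * ν)`-cyclotomic classes of `A` of type II′, the class
of `a` being paired with the class of `-p ^ ν • a`. -/
noncomputable def rII' (p ν : ℕ) (A : Type*) [AddCommGroup A] : ℕ :=
  {T : Set (Set A) | ∃ a : A, IsTypeII' p ν a ∧
    T = {cyclotomicClass (p ^ (2 * ν)) a, cyclotomicClass (p ^ (2 * ν)) (-(p ^ ν • a))}}.ncard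

end CyclotomicClasses

end HermitianLCD

namespace HermitianLCD

/-! ### Idempotents in finite algebras satisfying `x ^ |F| = x`. -/

section IdempotentCount

/-! Let `θ` be the `p ^ ν`-power Frobenius and `conj θ` the induced involution of the group algebra.
The Hermitian product of `u` and `v` is the coefficient at `0` of `u * conj θ v`, so complementary
dual codes are the ideals generated by self-conjugate idempotents
(`isHermitianComplementaryDual_iff`).

Following `conj θ` by the `p ^ ν`-th power gives the `F`-linear map induced by `g ↦ -p ^ ν g`. An
idempotent equals its powers, so the self-conjugate idempotents are those of the fixed subalgebra
`twistFixed` of this map. The square of the map is `x ↦ x ^ |F|`, hence `twistFixed` is a power `F ^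
d` with `2 ^ d` idempotents.

To find `d`: the twist is nilpotent on `P`, so fixed elements are supported on `A`. It permutes `A`,
so `d` is the number of its orbits there, and the orbit of `a` is the union of the classes of `a`
and `-p ^ ν a`: one class of type I′ or a pair of type II′. -/

theorem natCard_isIdempotentElem_field (K : Type*) [Field K] :
    Nat.card {e : K // IsIdempotentElem e} = 2 := by
  have h : {e : K | IsIdempotentElem e} = {0, 1} := by
    ext e
    simp [IsIdempotentElem.iff_eq_zero_or_one]
  calc Nat.card {e : K // IsIdempotentElem e} = {e : K | IsIdempotentElem e}.ncard := rfl
    _ = 2 := by rw [h, Set.ncard_pair zero_ne_one]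

theorem natCard_field_of_pow_card_eq_self (F K : Type*) [Field F] [Finite F] [Field K] [Finite K]
    [Algebra F K] (h : ∀ x : K, x ^ Nat.card F = x) : Nat.card K = Nat.card F := by
  classical
  have := Fintype.ofFinite K
  have hq : 1 < Nat.card F := Finite.one_lt_card
  refine le_antisymm ?_ (Nat.card_le_card_of_injective _ (algebraMap F K).injective)
  have hne := FiniteField.X_pow_card_sub_X_ne_zero K hq
  have hsub : (Finset.univ : Finset K).val ⊆
      (Polynomial.X ^ Nat.card F - Polynomial.X : Polynomial K).roots := by
    intro x _
    simp [Polynomial.mem_roots hne, h x]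
  have := Polynomial.card_le_degree_of_subset_roots hsub
  rwa [FiniteField.X_pow_card_sub_X_natDegree_eq K hq, Finset.card_univ,
    ← Nat.card_eq_fintype_card] at this

/-- A finite commutative algebra over `F` in which `x ^ |F| = x` holds identically is a power of
`F`, so it has `2 ^ d` idempotents, where `d` is its dimension. -/
theorem natCard_isIdempotentElem_of_pow_card_eq_self (F D : Type*) [Field F] [Finite F]
    [CommRing D] [Finite D] [Algebra F D] (h : ∀ x : D, x ^ Nat.card F = x) {d : ℕ}
    (hd : Nat.card D = Nat.card F ^ d) : Nat.card {e : D // IsIdempotentElem e} = 2 ^ d := by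
  have hq : 1 < Nat.card F := Finite.one_lt_card
  have hred : IsReduced D :=
    (isReduced_iff_pow_one_lt (Nat.card F) hq).2 fun x hx ↦ (h x).symm.trans hx
  let E := (IsArtinianRing.equivPi D).toRingEquiv
  have := Fintype.ofFinite (MaximalSpectrum D)
  have hcard (m : MaximalSpectrum D) : Nat.card (D ⧸ m.asIdeal) = Nat.card F := by
    let : Field (D ⧸ m.asIdeal) := Ideal.Quotient.field m.asIdeal
    have : Finite (D ⧸ m.asIdeal) := Finite.of_surjective _ Ideal.Quotient.mk_surjective
    refine natCard_field_of_pow_card_eq_self F (D ⧸ m.asIdeal) fun x ↦ ?_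
    obtain ⟨y, rfl⟩ := Ideal.Quotient.mk_surjective x
    rw [← map_pow, h]
  have htwo (m : MaximalSpectrum D) :
      Nat.card {e : D ⧸ m.asIdeal // IsIdempotentElem e} = 2 := by
    let : Field (D ⧸ m.asIdeal) := Ideal.Quotient.field m.asIdeal
    exact natCard_isIdempotentElem_field _
  -- Every residue field has `|F|` elements, so comparing cardinalities counts the factors.
  have hm : Fintype.card (MaximalSpectrum D) = d := by
    rw [Nat.card_congr E.toEquiv, Nat.card_pi] at hd
    simp only [hcard, Finset.prod_const, Finset.card_univ] at hd
    exact Nat.pow_right_injective hq hd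
  have e₁ : {e : D // IsIdempotentElem e} ≃
      {e : ∀ m : MaximalSpectrum D, D ⧸ m.asIdeal // ∀ m, IsIdempotentElem (e m)} :=
    E.toEquiv.subtypeEquiv fun x ↦ by
      rw [IsIdempotentElem, ← E.injective.eq_iff, map_mul]
      exact funext_iff
  rw [Nat.card_congr (e₁.trans Equiv.subtypePiEquivPi), Nat.card_pi]
  simp_rw [htwo, Finset.prod_const, Finset.card_univ, hm]

end IdempotentCount

/-! ### The conjugation and the trace form. -/

section Conjugation

variable {F G : Type*} [Field F] [AddCommGroup G]

/-- The map `∑ v_g Y^g ↦ ∑ θ(v_g) Y^(-g)` on the group algebra. -/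
noncomputable def conj (θ : F →+* F) : AddMonoidAlgebra F G →+* AddMonoidAlgebra F G :=
  (AddMonoidAlgebra.mapRingHom G θ).comp (AddMonoidAlgebra.mapDomainRingHom F (-AddMonoidHom.id G))

theorem conj_single (θ : F →+* F) (g : G) (r : F) :
    conj θ (AddMonoidAlgebra.single g r) = AddMonoidAlgebra.single (-g) (θ r) := by
  simp [conj]

theorem coeff_conj (θ : F →+* F) (v : AddMonoidAlgebra F G) (g : G) :
    (conj θ v).coeff g = θ (v.coeff (-g)) := by
  have h := Finsupp.mapDomain_apply (neg_injective (G := G)) v.coeff (-g)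
  rw [neg_neg] at h
  simp only [conj, RingHom.comp_apply, AddMonoidAlgebra.coeff_mapRingHom]
  exact congrArg θ h

theorem conj_conj {θ : F →+* F} (hθ : ∀ x, θ (θ x) = x) (v : AddMonoidAlgebra F G) :
    conj θ (conj θ v) = v := by
  ext g
  simp [coeff_conj, hθ]

theorem coeff_mul_conj_zero [Fintype G] (θ : F →+* F) (u v : AddMonoidAlgebra F G) :
    (u * conj θ v).coeff 0 = ∑ g, u.coeff g * θ (v.coeff g) := by
  rw [AddMonoidAlgebra.coeff_mul_apply_left, Finsupp.sum_fintype _ _ (by simp)]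
  simp [coeff_conj]

/-- The symmetric bilinear form `(u, v) ↦ (u * v)_0` on the group algebra. -/
noncomputable def traceForm (F G : Type*) [Field F] [AddCommGroup G] :
    LinearMap.BilinForm F (AddMonoidAlgebra F G) :=
  (LinearMap.mul F (AddMonoidAlgebra F G)).compr₂
    (Finsupp.lapply 0 ∘ₗ (AddMonoidAlgebra.coeffLinearEquiv F).toLinearMap)

theorem traceForm_apply (u v : AddMonoidAlgebra F G) : traceForm F G u v = (u * v).coeff 0 := rfl

theorem eq_zero_of_forall_coeff_mul {v : AddMonoidAlgebra F G}
    (h : ∀ g : G, (AddMonoidAlgebra.single g 1 * v).coeff 0 = 0) : v = 0 := by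
  ext g
  simpa using h (-g)

theorem traceForm_nondegenerate : (traceForm F G).Nondegenerate := by
  have h : (traceForm F G).SeparatingRight := fun v hv ↦
    eq_zero_of_forall_coeff_mul fun g ↦ hv _
  refine ⟨fun v hv ↦ h v fun u ↦ ?_, h⟩
  rw [← hv u, traceForm_apply, traceForm_apply, mul_comm]

end Conjugation

/-! ### Complementary dual codes as self-conjugate idempotents. -/

section Codes

variable {F G : Type*} [Field F] [AddCommGroup G] [Fintype G] {p ν : ℕ} {θ : F →+* F}

/-- An ideal is stable under translation by monomials, so vanishing of the coefficient at `0` forces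
all coefficients to vanish. -/
theorem mem_hermitianDual_iff (hθ : ∀ x, θ x = x ^ p ^ ν) {C : Ideal (AddMonoidAlgebra F G)}
    {v : AddMonoidAlgebra F G} : v ∈ hermitianDual p ν C ↔ ∀ c ∈ C, c * conj θ v = 0 := by
  have h (u : AddMonoidAlgebra F G) : hermitianInner p ν u v = (u * conj θ v).coeff 0 := by
    simp [coeff_mul_conj_zero, hermitianInner, hθ]
  simp only [hermitianDual, Set.mem_ofPred_eq, h]
  refine ⟨fun hv c hc ↦ eq_zero_of_forall_coeff_mul fun g ↦ ?_, fun hv c hc ↦ by simp [hv c hc]⟩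
  rw [← mul_assoc]
  exact hv _ (C.mul_mem_left _ hc)

/-- The dual is the trace-form orthogonal of the conjugate of `C`, so its dimension is complementary
to that of `C`; a trivial intersection then gives a direct sum. -/
theorem exists_add_eq_one_of_isHermitianComplementaryDual [Finite F] (hθ : ∀ x, θ x = x ^ p ^ ν)
    (hθθ : ∀ x, θ (θ x) = x) {C : Ideal (AddMonoidAlgebra F G)}
    (hC : IsHermitianComplementaryDual p ν C) :
    ∃ e ∈ C, ∃ f ∈ hermitianDual p ν C, e + f = 1 := by
  have : Module.Finite F (AddMonoidAlgebra F G) :=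
    Module.Finite.equiv (AddMonoidAlgebra.coeffLinearEquiv (M := G) (S := F) F).symm
  have : Finite (AddMonoidAlgebra F G) := Module.finite_of_finite F
  have hinv : Function.Involutive (conj θ : AddMonoidAlgebra F G → _) := conj_conj hθθ
  let U : Submodule F (AddMonoidAlgebra F G) := C.restrictScalars F
  let W : Submodule F (AddMonoidAlgebra F G) := (C.comap (conj θ)).restrictScalars F
  let K := (traceForm F G).orthogonal W
  have hK (v : AddMonoidAlgebra F G) : v ∈ K ↔ v ∈ hermitianDual p ν C := by
    rw [mem_hermitianDual_iff hθ, LinearMap.BilinForm.mem_orthogonal_iff]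
    constructor
    · intro h c hc
      rw [← hinv (c * conj θ v), map_mul, hinv v, map_eq_zero_iff _ hinv.injective]
      refine eq_zero_of_forall_coeff_mul fun g ↦ ?_
      rw [← mul_assoc]
      refine h _ ?_
      change conj θ _ ∈ C
      rw [map_mul, hinv c]
      exact C.mul_mem_left _ hc
    · intro h w hw
      have := congrArg (conj θ) (h _ hw)
      rw [map_mul, hinv w, hinv v, map_zero] at this
      change (w * v).coeff 0 = 0
      rw [this]
      rfl
  -- `conj θ` is only semilinear, so ranks are compared through cardinalities.
  have hcard : Nat.card U = Nat.card W :=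
    Nat.card_congr (hinv.toPerm.subtypeEquiv fun x ↦ by
      change x ∈ C ↔ conj θ (conj θ x) ∈ C
      rw [hinv x])
  have hrank : Module.finrank F U = Module.finrank F W := by
    rw [Module.natCard_eq_pow_finrank (K := F) (V := U),
      Module.natCard_eq_pow_finrank (K := F) (V := W)] at hcard
    exact Nat.pow_right_injective Finite.one_lt_card hcard
  have hdisj : Disjoint U K := by
    rw [Submodule.disjoint_def]
    intro x hxU hxK
    have : x ∈ (C : Set (AddMonoidAlgebra F G)) ∩ hermitianDual p ν C := ⟨hxU, (hK x).1 hxK⟩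
    rw [hC] at this
    exact this
  have hsum : Module.finrank F U + Module.finrank F K = Module.finrank F (AddMonoidAlgebra F G) := by
    have h₁ : Module.finrank F K =
        Module.finrank F (AddMonoidAlgebra F G) - Module.finrank F W :=
      LinearMap.BilinForm.finrank_orthogonal traceForm_nondegenerate W
    have h₂ := Submodule.finrank_le W
    omega
  have htop := Submodule.eq_top_of_disjoint U K hsum.ge hdisj
  have h1 : (1 : AddMonoidAlgebra F G) ∈ U ⊔ K := htop ▸ Submodule.mem_top
  obtain ⟨e, he, f, hf, hef⟩ := Submodule.mem_sup.1 h1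
  exact ⟨e, he, f, (hK f).1 hf, hef⟩

/-- Hermitian complementary dual codes are exactly the ideals generated by self-conjugate
idempotents. -/
theorem isHermitianComplementaryDual_iff [Finite F] (hθ : ∀ x, θ x = x ^ p ^ ν)
    (hθθ : ∀ x, θ (θ x) = x) (C : Ideal (AddMonoidAlgebra F G)) :
    IsHermitianComplementaryDual p ν C ↔
      ∃ e, (IsIdempotentElem e ∧ conj θ e = e) ∧ Ideal.span {e} = C := by
  have hinv : Function.Involutive (conj θ : AddMonoidAlgebra F G → _) := conj_conj hθθ
  constructor
  · intro hC
    obtain ⟨e, he, f, hf, hef⟩ := exists_add_eq_one_of_isHermitianComplementaryDual hθ hθθ hC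
    have hzero {x : AddMonoidAlgebra F G} (hx : x ∈ C) (hx' : x ∈ hermitianDual p ν C) :
        x = 0 := by
      have : x ∈ (C : Set (AddMonoidAlgebra F G)) ∩ hermitianDual p ν C := ⟨hx, hx'⟩
      rw [hC] at this
      exact this
    have hmul {c : AddMonoidAlgebra F G} (hc : c ∈ C) : c * f = 0 := by
      refine hzero (C.mul_mem_right _ hc) ?_
      rw [mem_hermitianDual_iff hθ] at hf ⊢
      intro d hd
      rw [map_mul, mul_left_comm, hf d hd, mul_zero]
    have hce {c : AddMonoidAlgebra F G} (hc : c ∈ C) : c * e = c := by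
      rw [← sub_eq_zero, ← neg_eq_zero, neg_sub]
      calc c - c * e = c * (e + f) - c * e := by rw [hef, mul_one]
        _ = 0 := by rw [mul_add, hmul hc, add_zero, sub_self]
    -- This is `e * conj θ f = 0` with `f = 1 - e`; the left side is self-conjugate, hence so is
    -- `e`.
    have hee : e * conj θ e = e := by
      have h := (mem_hermitianDual_iff hθ).1 hf e he
      rw [eq_sub_of_add_eq' hef, map_sub, map_one, mul_sub, mul_one, sub_eq_zero] at h
      exact h.symm
    refine ⟨e, ⟨hce he, ?_⟩, le_antisymm ?_ fun c hc ↦ ?_⟩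
    · have h := congrArg (conj θ) hee
      rw [map_mul, hinv e, mul_comm, hee] at h
      exact h.symm
    · rwa [Ideal.span_singleton_le_iff_mem]
    · exact Ideal.mem_span_singleton'.2 ⟨c, hce hc⟩
  · rintro ⟨e, ⟨he, hconj⟩, rfl⟩
    refine Set.Subset.antisymm ?_ ?_
    · rintro v ⟨hv, hv'⟩
      obtain ⟨r, rfl⟩ := Ideal.mem_span_singleton'.1 hv
      have h := (mem_hermitianDual_iff hθ).1 hv' e (Ideal.mem_span_singleton_self e)
      rw [map_mul, hconj, mul_left_comm, he.eq] at h
      have h' := congrArg (conj θ) h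
      rwa [map_mul, hinv r, hconj, map_zero] at h'
    · rintro _ rfl
      exact ⟨zero_mem _, (mem_hermitianDual_iff hθ).2 fun c _ ↦ by simp⟩

theorem _root_.IsIdempotentElem.eq_of_span_singleton_eq {R : Type*} [CommRing R] {e f : R}
    (he : IsIdempotentElem e) (hf : IsIdempotentElem f)
    (h : Ideal.span {e} = Ideal.span {f}) : e = f := by
  obtain ⟨a, ha⟩ := Ideal.mem_span_singleton'.1 (h ▸ Ideal.mem_span_singleton_self e)
  obtain ⟨b, hb⟩ := Ideal.mem_span_singleton'.1 (h ▸ Ideal.mem_span_singleton_self f)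
  calc e = e * f := by rw [← ha, mul_assoc, hf.eq]
    _ = f := by rw [← hb, mul_left_comm, he.eq]

theorem numHermitianComplementaryDual_eq_ncard [Finite F] (hθ : ∀ x, θ x = x ^ p ^ ν)
    (hθθ : ∀ x, θ (θ x) = x) :
    numHermitianComplementaryDual p ν F G =
      {e : AddMonoidAlgebra F G | IsIdempotentElem e ∧ conj θ e = e}.ncard := by
  have h : {C : Ideal (AddMonoidAlgebra F G) | IsHermitianComplementaryDual p ν C} =
      (fun e ↦ Ideal.span {e}) '' {e : AddMonoidAlgebra F G | IsIdempotentElem e ∧ conj θ e = e} := by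
    ext C
    exact isHermitianComplementaryDual_iff hθ hθθ C
  rw [numHermitianComplementaryDual, h, Set.InjOn.ncard_image]
  exact fun e he f hf hef ↦ he.1.eq_of_span_singleton_eq hf.1 hef

end Codes

/-! ### The twist endomorphism and its fixed subalgebra. -/

section Twist

variable {F G H : Type*} [Field F] [AddCommGroup G] [AddCommGroup H] {p ν : ℕ}

/-- The endomorphism `g ↦ -(p ^ ν • g)`. -/
def twist (p ν : ℕ) (G : Type*) [AddCommGroup G] : G →+ G where
  toFun g := -(p ^ ν • g)
  map_zero' := by simp
  map_add' a b := by rw [smul_add, neg_add]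

theorem twist_apply (g : G) : twist p ν G g = -(p ^ ν • g) := rfl

theorem twist_twist (g : G) : twist p ν G (twist p ν G g) = p ^ (2 * ν) • g := by
  simp only [twist_apply, smul_neg, neg_neg]
  rw [smul_smul, ← pow_add, two_mul]

theorem map_twist (j : H →+ G) (h : H) : j (twist p ν H h) = twist p ν G (j h) := by
  simp [twist_apply]

theorem map_iterate_twist (j : H →+ G) (N : ℕ) (h : H) :
    j ((twist p ν H)^[N] h) = (twist p ν G)^[N] (j h) :=
  Function.Semiconj.iterate_right (f := j) (map_twist j) N h

theorem twist_injective [Finite G] (hp : p.Prime) (hG : ¬ p ∣ Nat.card G) :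
    Function.Injective (twist p ν G) := by
  have h : (Nat.card G).Coprime (p ^ ν) :=
    (((Nat.Prime.coprime_iff_not_dvd hp).2 hG).pow_left ν).symm
  exact neg_injective.comp (nsmulCoprime h).injective

/-- As `ν > 0`, the scalar `(-p ^ ν) ^ N` is divisible by `p ^ N = |G|`. -/
theorem exists_iterate_twist_eq_zero [Finite G] (hp : p.Prime) (hν : 0 < ν)
    (hG : IsPGroup p (Multiplicative G)) : ∃ N, ∀ g : G, (twist p ν G)^[N] g = 0 := by
  have := Fact.mk hp
  obtain ⟨N, hN⟩ := IsPGroup.iff_card.1 hG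
  have hN' : Nat.card G = p ^ N := hN
  have key (k : ℕ) (g : G) : (twist p ν G)^[k] g = (-(p : ℤ) ^ ν) ^ k • g := by
    induction k with
    | zero => simp
    | succ k ih =>
      rw [Function.iterate_succ_apply', ih, twist_apply, pow_succ', mul_smul, neg_smul,
        ← natCast_zsmul, Nat.cast_pow]
  refine ⟨N, fun g ↦ ?_⟩
  have hdvd : ((Nat.card G : ℕ) : ℤ) ∣ (-(p : ℤ) ^ ν) ^ N := by
    rw [hN', Nat.cast_pow]
    exact pow_dvd_pow_of_dvd (dvd_neg.2 (dvd_pow_self _ hν.ne')) N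
  obtain ⟨c, hc⟩ := hdvd
  rw [key, hc, mul_comm, mul_smul, natCast_zsmul, card_nsmul_eq_zero', smul_zero]

/-- The `F`-algebra endomorphism of the group algebra induced by `twist`. -/
noncomputable def twistAlgHom (p ν : ℕ) (F G : Type*) [Field F] [AddCommGroup G] :
    AddMonoidAlgebra F G →ₐ[F] AddMonoidAlgebra F G :=
  AddMonoidAlgebra.mapDomainAlgHom F F (twist p ν G)

theorem twistAlgHom_apply (x : AddMonoidAlgebra F G) :
    twistAlgHom p ν F G x = AddMonoidAlgebra.mapDomain (twist p ν G) x := rfl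

theorem iterate_twistAlgHom (N : ℕ) (x : AddMonoidAlgebra F G) :
    (twistAlgHom p ν F G)^[N] x = AddMonoidAlgebra.mapDomain ((twist p ν G)^[N]) x := by
  induction N with
  | zero => ext; simp
  | succ N ih =>
    rw [Function.iterate_succ_apply', ih, twistAlgHom_apply, Function.iterate_succ']
    ext
    simp [Finsupp.mapDomain_comp]

theorem twistAlgHom_eq_conj_pow [CharP F p] (hp : p.Prime) {θ : F →+* F}
    (hθ : ∀ x, θ x = x ^ p ^ ν) (hθθ : ∀ x, θ (θ x) = x) (x : AddMonoidAlgebra F G) :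
    twistAlgHom p ν F G x = conj θ x ^ p ^ ν := by
  have := Fact.mk hp
  have : CharP (AddMonoidAlgebra F G) p :=
    charP_of_injective_algebraMap (algebraMap F (AddMonoidAlgebra F G)).injective p
  induction x using AddMonoidAlgebra.induction_linear with
  | zero => simp [hp.ne_zero]
  | add x y hx hy => rw [map_add, map_add, add_pow_char_pow, hx, hy]
  | single g r =>
    rw [conj_single, AddMonoidAlgebra.single_pow, ← hθ, hθθ, twistAlgHom_apply,
      AddMonoidAlgebra.mapDomain_single, twist_apply, smul_neg]

theorem twistAlgHom_twistAlgHom [CharP F p] (hp : p.Prime) {θ : F →+* F}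
    (hθ : ∀ x, θ x = x ^ p ^ ν) (hθθ : ∀ x, θ (θ x) = x) (x : AddMonoidAlgebra F G) :
    twistAlgHom p ν F G (twistAlgHom p ν F G x) = x ^ p ^ (2 * ν) := by
  rw [twistAlgHom_eq_conj_pow hp hθ hθθ, twistAlgHom_eq_conj_pow hp hθ hθθ, map_pow,
    conj_conj hθθ, ← pow_mul, ← pow_add, two_mul]

theorem conj_eq_self_iff [CharP F p] (hp : p.Prime) {θ : F →+* F}
    (hθ : ∀ x, θ x = x ^ p ^ ν) (hθθ : ∀ x, θ (θ x) = x) {e : AddMonoidAlgebra F G}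
    (he : IsIdempotentElem e) : conj θ e = e ↔ twistAlgHom p ν F G e = e := by
  rw [twistAlgHom_eq_conj_pow hp hθ hθθ,
    (he.map (conj θ)).pow_eq (pow_ne_zero ν hp.ne_zero)]

/-- The subalgebra of the group algebra fixed by `twistAlgHom`. -/
noncomputable def twistFixed (p ν : ℕ) (F G : Type*) [Field F] [AddCommGroup G] :
    Subalgebra F (AddMonoidAlgebra F G) :=
  AlgHom.equalizer (twistAlgHom p ν F G) (AlgHom.id F _)

theorem mem_twistFixed {x : AddMonoidAlgebra F G} :
    x ∈ twistFixed p ν F G ↔ twistAlgHom p ν F G x = x := Iff.rfl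

/-- A fixed element equals its image under the `N`-th iterate, so it is supported on the range of
`j`. -/
theorem natCard_twistFixed_eq_of_injective (j : H →+ G) (hj : Function.Injective j)
    (hr : ∃ N, ∀ g : G, (twist p ν G)^[N] g ∈ Set.range j) :
    Nat.card (twistFixed p ν F G) = Nat.card (twistFixed p ν F H) := by
  let J : AddMonoidAlgebra F H → AddMonoidAlgebra F G := AddMonoidAlgebra.mapDomain j
  have hJ : Function.Injective J := AddMonoidAlgebra.mapDomain_injective hj
  have hcomm (x : AddMonoidAlgebra F H) : J (twistAlgHom p ν F H x) = twistAlgHom p ν F G (J x) := by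
    rw [twistAlgHom_apply, twistAlgHom_apply]
    ext1
    simp only [J, AddMonoidAlgebra.coeff_mapDomain, ← Finsupp.mapDomain_comp]
    congr 1
    exact funext (map_twist j)
  let Φ (x : twistFixed p ν F H) : twistFixed p ν F G :=
    ⟨J x, by rw [mem_twistFixed, ← hcomm, mem_twistFixed.1 x.2]⟩
  refine (Nat.card_congr (Equiv.ofBijective Φ ⟨fun x y hxy ↦ ?_, fun ⟨x, hx⟩ ↦ ?_⟩)).symm
  · exact Subtype.ext (hJ (congrArg Subtype.val hxy))
  · obtain ⟨N, hN⟩ := hr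
    -- `ρ` is a mere function; pushing forward supports needs no additivity.
    choose ρ hρ using hN
    have hx' : J (AddMonoidAlgebra.mapDomain ρ x) = x := by
      have h : (twistAlgHom p ν F G)^[N] x = x := Function.iterate_fixed hx N
      rw [iterate_twistAlgHom] at h
      conv_rhs => rw [← h]
      ext1
      simp only [J, AddMonoidAlgebra.coeff_mapDomain, ← Finsupp.mapDomain_comp]
      congr 1
      exact funext hρ
    refine ⟨⟨AddMonoidAlgebra.mapDomain ρ x, hJ ?_⟩, Subtype.ext hx'⟩
    change J (twistAlgHom p ν F H _) = J (AddMonoidAlgebra.mapDomain ρ x)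
    rw [hcomm, hx']
    exact hx

theorem natCard_twistFixed_eq_natCard_functions [Finite G]
    (hinj : Function.Injective (twist p ν G)) :
    Nat.card (twistFixed p ν F G) = Nat.card {f : G → F // ∀ g, f (twist p ν G g) = f g} := by
  refine Nat.card_congr ((AddMonoidAlgebra.coeffEquiv.trans Finsupp.equivFunOnFinite).subtypeEquiv
    fun x ↦ ?_)
  have h (g : G) : (twistAlgHom p ν F G x).coeff (twist p ν G g) = x.coeff g :=
    Finsupp.mapDomain_apply hinj x.coeff g
  change twistAlgHom p ν F G x = x ↔ ∀ g, x.coeff (twist p ν G g) = x.coeff g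
  constructor
  · intro hx g
    conv_rhs => rw [← h, hx]
  · intro hx
    ext g
    obtain ⟨g, rfl⟩ := Finite.surjective_of_injective hinj g
    rw [h, hx]

theorem ncard_idempotent_conj_eq [Finite F] [Finite G] [CharP F p] (hp : p.Prime) {θ : F →+* F}
    (hF : Nat.card F = p ^ (2 * ν)) (hθ : ∀ x, θ x = x ^ p ^ ν) (hθθ : ∀ x, θ (θ x) = x) {d : ℕ}
    (hd : Nat.card (twistFixed p ν F G) = Nat.card F ^ d) :
    {e : AddMonoidAlgebra F G | IsIdempotentElem e ∧ conj θ e = e}.ncard = 2 ^ d := by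
  have : Finite (AddMonoidAlgebra F G) :=
    Finite.of_equiv _ (AddMonoidAlgebra.coeffEquiv.trans Finsupp.equivFunOnFinite).symm
  rw [← natCard_isIdempotentElem_of_pow_card_eq_self F (twistFixed p ν F G) (fun x ↦ ?_) hd]
  · refine Nat.card_congr
      ⟨fun e ↦ ⟨⟨e.1, (conj_eq_self_iff hp hθ hθθ e.2.1).1 e.2.2⟩, Subtype.ext e.2.1⟩,
        fun e ↦ ⟨e.1.1, congrArg Subtype.val e.2,
          (conj_eq_self_iff hp hθ hθθ (congrArg Subtype.val e.2)).2 e.1.2⟩,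
        fun e ↦ rfl, fun e ↦ rfl⟩
  · have h := twistAlgHom_twistAlgHom hp hθ hθθ (x : AddMonoidAlgebra F G)
    rw [mem_twistFixed.1 x.2, mem_twistFixed.1 x.2, ← hF] at h
    exact Subtype.ext h.symm

end Twist

/-! ### Twist orbits and pairs of cyclotomic classes. -/

section ClassPairs

variable {A : Type*} [AddCommGroup A] {p ν : ℕ}

theorem mem_cyclotomicClass_self (q : ℕ) (a : A) : a ∈ cyclotomicClass q a := ⟨0, by simp⟩

theorem cyclotomicClass_nsmul [Finite A] {q : ℕ} (hq : Function.Injective fun a : A ↦ q • a)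
    (a : A) : cyclotomicClass q (q • a) = cyclotomicClass q a := by
  ext b
  constructor
  · rintro ⟨i, rfl⟩
    exact ⟨i + 1, by rw [smul_smul, pow_succ]⟩
  · rintro ⟨i, rfl⟩
    obtain ⟨n, hn, hper⟩ := hq.mem_periodicPts a
    have key (k : ℕ) : (fun a : A ↦ q • a)^[k] a = q ^ k • a := by
      rw [smul_iterate]
    have ha : q ^ n • a = a := by
      rw [← key]
      exact hper
    -- The period `n` of `a` lets the extra factor `q` be absorbed: `(n - 1) + 1 = n`.
    refine ⟨i + (n - 1), ?_⟩
    conv_lhs => rw [← ha]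
    rw [smul_smul, smul_smul, ← pow_add, ← pow_succ, add_assoc, Nat.sub_add_cancel hn]

/-- The pair formed by the cyclotomic classes of `a` and of `-p ^ ν • a`. -/
def classPair (p ν : ℕ) (a : A) : Set (Set A) :=
  {cyclotomicClass (p ^ (2 * ν)) a, cyclotomicClass (p ^ (2 * ν)) (-(p ^ ν • a))}

theorem classPair_twist [Finite A] (hinj : Function.Injective (twist p ν A)) (a : A) :
    classPair p ν (twist p ν A a) = classPair p ν a := by
  have hq : Function.Injective fun a : A ↦ p ^ (2 * ν) • a := by
    simpa only [Function.comp_def, twist_twist] using hinj.comp hinj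
  simp only [classPair, ← twist_apply]
  rw [twist_twist, cyclotomicClass_nsmul hq, Set.pair_comm]

theorem apply_eq_of_mem_cyclotomicClass {X : Type*} {f : A → X}
    (hf : ∀ a, f (twist p ν A a) = f a) {a b : A} (h : a ∈ cyclotomicClass (p ^ (2 * ν)) b) :
    f a = f b := by
  obtain ⟨i, rfl⟩ := h
  induction i with
  | zero => simp
  | succ i ih => rw [pow_succ', mul_smul, ← twist_twist, hf, hf, ih]

theorem apply_eq_of_classPair_eq {X : Type*} {f : A → X} (hf : ∀ a, f (twist p ν A a) = f a)
    {a b : A} (h : classPair p ν a = classPair p ν b) : f a = f b := by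
  have ha : cyclotomicClass (p ^ (2 * ν)) a ∈ classPair p ν b := h ▸ Set.mem_insert _ _
  have hself := mem_cyclotomicClass_self (p ^ (2 * ν)) a
  rcases ha with ha | ha
  · exact apply_eq_of_mem_cyclotomicClass hf (ha ▸ hself)
  · rw [Set.mem_singleton_iff] at ha
    rw [apply_eq_of_mem_cyclotomicClass hf (ha ▸ hself), ← twist_apply, hf]

/-- `classPair` is a complete invariant of twist orbits, so invariant functions factor uniquely
through it. -/
theorem natCard_functions_eq_pow [Finite A] (hinj : Function.Injective (twist p ν A))
    (F : Type*) [Finite F] :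
    Nat.card {f : A → F // ∀ a, f (twist p ν A a) = f a} =
      Nat.card F ^ (Set.range (classPair p ν : A → _)).ncard := by
  let Φ (g : Set.range (classPair p ν : A → _) → F) :
      {f : A → F // ∀ a, f (twist p ν A a) = f a} :=
    ⟨fun a ↦ g ⟨classPair p ν a, a, rfl⟩, fun a ↦ by simp only [classPair_twist hinj]⟩
  have hΦ : Function.Bijective Φ := by
    constructor
    · intro g g' h
      ext ⟨_, a, rfl⟩
      exact congrFun (congrArg Subtype.val h) a
    · rintro ⟨f, hf⟩
      refine ⟨fun T ↦ f T.2.choose, Subtype.ext (funext fun a ↦ ?_)⟩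
      exact apply_eq_of_classPair_eq hf (Set.mem_range_self (f := classPair p ν) a).choose_spec
  rw [← Nat.card_congr (Equiv.ofBijective Φ hΦ), Nat.card_fun]
  rfl

/-- Type I′ pairs collapse to singletons, while type II′ pairs have two distinct members. -/
theorem ncard_range_classPair [Finite A] :
    (Set.range (classPair p ν : A → _)).ncard = rI' p ν A + rII' p ν A := by
  have h : Set.range (classPair p ν : A → _) =
      (singleton '' {S : Set A | ∃ a, IsTypeI' p ν a ∧ S = cyclotomicClass (p ^ (2 * ν)) a}) ∪
        {T : Set (Set A) | ∃ a : A, IsTypeII' p ν a ∧ T = classPair p ν a} := by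
    have hI {a : A} (ha : IsTypeI' p ν a) : {cyclotomicClass (p ^ (2 * ν)) a} = classPair p ν a := by
      rw [classPair, ← ha, Set.pair_eq_singleton]
    ext T
    constructor
    · rintro ⟨a, rfl⟩
      by_cases ha : IsTypeI' p ν a
      · exact Or.inl ⟨_, ⟨a, ha, rfl⟩, hI ha⟩
      · exact Or.inr ⟨a, ha, rfl⟩
    · rintro (⟨_, ⟨a, ha, rfl⟩, rfl⟩ | ⟨a, -, rfl⟩)
      · exact ⟨a, (hI ha).symm⟩
      · exact ⟨a, rfl⟩
  rw [h, Set.ncard_union_eq, Set.ncard_image_of_injective _ Set.singleton_injective]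
  · rfl
  · rw [Set.disjoint_left]
    rintro _ ⟨S, -, rfl⟩ ⟨a, ha, hS⟩
    have h₁ : cyclotomicClass (p ^ (2 * ν)) a ∈ ({S} : Set (Set A)) := hS ▸ Set.mem_insert _ _
    have h₂ : cyclotomicClass (p ^ (2 * ν)) (-(p ^ ν • a)) ∈ ({S} : Set (Set A)) :=
      hS ▸ Set.mem_insert_of_mem _ rfl
    exact ha ((Set.mem_singleton_iff.1 h₁).trans (Set.mem_singleton_iff.1 h₂).symm)

end ClassPairs

/-! ### The count for `A × P`. -/

theorem numHermitianComplementaryDual_prod (p ν : ℕ) (hp : p.Prime) (hν : 0 < ν)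
    (F : Type*) [Field F] [Fintype F] (hF : Fintype.card F = p ^ (2 * ν))
    (A : Type*) [AddCommGroup A] [Fintype A] (hA : ¬ p ∣ Fintype.card A)
    (P : Type*) [AddCommGroup P] [Fintype P] (hP : IsPGroup p (Multiplicative P)) :
    numHermitianComplementaryDual p ν F (A × P) = 2 ^ (rI' p ν A + rII' p ν A) := by
  have := Fact.mk hp
  have : CharP F p := charP_of_card_eq_prime_pow hF
  rw [← Nat.card_eq_fintype_card] at hA
  have hθ (x : F) : iterateFrobenius F p ν x = x ^ p ^ ν := iterateFrobenius_def ..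
  have hθθ (x : F) : iterateFrobenius F p ν (iterateFrobenius F p ν x) = x := by
    rw [hθ, hθ, ← pow_mul, ← pow_add, ← two_mul, ← hF, FiniteField.pow_card]
  have hinj := twist_injective (ν := ν) hp hA
  rw [numHermitianComplementaryDual_eq_ncard hθ hθθ]
  refine ncard_idempotent_conj_eq hp (Nat.card_eq_fintype_card.trans hF) hθ hθθ ?_
  rw [natCard_twistFixed_eq_of_injective (AddMonoidHom.inl A P) (Prod.mk_left_injective 0),
    natCard_twistFixed_eq_natCard_functions hinj, natCard_functions_eq_pow hinj,
    ncard_range_classPair]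
  obtain ⟨N, hN⟩ := exists_iterate_twist_eq_zero hp hν hP
  refine ⟨N, fun g ↦ ⟨(twist p ν A)^[N] g.1, Prod.ext ?_ ?_⟩⟩
  · exact map_iterate_twist (AddMonoidHom.fst A P) N g |>.symm
  · exact (hN g.2).symm.trans (map_iterate_twist (AddMonoidHom.snd A P) N g).symm

end HermitianLCD

theorem mainTheorem3 (p ν : ℕ) (hp : p.Prime) (hν : 0 < ν)
    (F : Type*) [Field F] [Fintype F] (hF : Fintype.card F = p ^ (2 * ν))
    (A : Type*) [AddCommGroup A] [Fintype A] (hA : ¬ p ∣ Fintype.card A)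
    (P : Type*) [AddCommGroup P] [Fintype P] (hP : IsPGroup p (Multiplicative P)) :
    HermitianLCD.numHermitianComplementaryDual p ν F (A × P) =
        2 ^ (HermitianLCD.rI' p ν A + HermitianLCD.rII' p ν A) ∧
      ∀ (P' : Type*) [AddCommGroup P'] [Fintype P'], IsPGroup p (Multiplicative P') →
        HermitianLCD.numHermitianComplementaryDual p ν F (A × P) =
          HermitianLCD.numHermitianComplementaryDual p ν F (A × P') := by
  have h := HermitianLCD.numHermitianComplementaryDual_prod p ν hp hν F hF A hA P hP
  exact ⟨h, fun P' _ _ hP' ↦ h.trans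
    (HermitianLCD.numHermitianComplementaryDual_prod p ν hp hν F hF A hA P' hP').symm⟩
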